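/- **Conventions.** A first-order theory $T$ is *finite-dimensional* if there is a function $\dim$ from the interpretable sets in models of $T$ (quotients of definable sets by definable equivalence relations, parameters allowed) to $\omega\cup\{-\infty\}$ such that: (Invariance) the dimension of an interpretable set given by fixed formulas with parameters $a$ depends only on the type of $a$ over $\emptyset$; (Algebraicity) $\dim\emptyset=-\infty$, and for $X\neq\emptyset$, $\dim X=0$ if and only if $X$ is finite; (Union) $\dim(X\cup Y)=\max\{\dim X,\dim Y\}$; (Fibration) for every interpretable map $f:X\to Y$ and $k\in\omega$, if $\dim f^{-1}(y)\ge k$ for all $y\in Y$ then $\dim X\ge\dim Y+k$, and if $\dim f^{-1}(y)\le k$ for all $y\in Y$ then $\dim X\le \dim Y+k$. Let $\mathfrak g$ be a Lie ring and $A$ a $\mathfrak g$-module, that is, an abelian group on which $\mathfrak g$ acts through a homomorphism of Lie rings $\mathfrak g\to\operatorname{End}(A)$. Put $\widetilde C_A(\mathfrak g)=\{a\in A:\mathfrak g\cdot a\text{ is finite}\}$, $\widetilde C_{\mathfrak g}(A)=\{g\in\mathfrak g: g\cdot A\text{ is finite}\}$ and $\widetilde Z(\mathfrak g)=\{g\in\mathfrak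 g:[g,\mathfrak g]\text{ is finite}\}$. A *partial homomorphism* from $\mathfrak g$ to $A$ is a homomorphism of abelian groups $f:\operatorname{Dom}(f)\to A$ with $\operatorname{Dom}(f)$ a subgroup of finite index in $(\mathfrak g,+)$. Sums are taken on the intersection of the domains, and $f\sim f'$ if $f-f'$ has finite image; the classes $[f]$ form an abelian group. For $g\in\operatorname{Dom}(f)$ let $$D^f_g=\{g'\in\operatorname{Dom}(f):[g,g']\in\operatorname{Dom}(f),\ f([g,g'])=g\cdot f(g')-g'\cdot f(g)\},$$ and let $D^f=\{g\in\operatorname{Dom}(f): D^f_g\text{ has finite index in }\mathfrak g\}$. Then $f$ is an *almost derivation* if $D^f$ has finite index in $\mathfrak g$. The classes of almost derivations form a group $\operatorname{AlmDer}(\mathfrak g,A)$, which contains the class of $d(a):g\mapsto g\cdot a$ for each $a\in A$, and $$\widetilde H^1(\mathfrak g,A)=\operatorname{AlmDer}(\mathfrak g,A)/\{[d(a)]:a\in A\}.$$ Two abelian groups $G,H$ are *isogenous* if there are subgroups of finite index $B\le G$, $C\le H$ and finite subgroups $B_1\le B$, $C_1\le C$ with $B/B_1\cong C/C_1$. **Statement.**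 Let $(\mathfrak g,A)$ be a module definable in a model of a finite-dimensional theory: the Lie ring $\mathfrak g$, the abelian group $A$ and the action are definable with parameters (more generally, interpretable). Assume that $\widetilde C_A(\mathfrak g)=\{0\}$. Let $\mathfrak h$ be a definable ideal of $\mathfrak g$ contained in $\widetilde C_{\mathfrak g}(A)\cap\widetilde Z(\mathfrak g)$. Then $\mathfrak h$ acts trivially on $A$, so that $A$ is a $\mathfrak g/\mathfrak h$-module, and $\widetilde H^1(\mathfrak g/\mathfrak h,A)$ is isogenous to $\widetilde H^1(\mathfrak g,A)$. -/

import Mathlib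

universe u v w

namespace AlmostCohomology

/-! ### Interpretable sets and finite-dimensional theories -/

section Interpretable

/-- An interpretable set of `M`: the quotient of a set `carrier ⊆ M ^ n` by an equivalence relation,
both definable with parameters from `M`. A definable set is the case where the relation is
equality. -/
structure InterpretableSet (L : FirstOrder.Language.{u, v}) (M : Type w) [L.Structure M] (n : ℕ) where
  carrier : Set (Fin n → M)
  setoid : Setoid carrier
  definable_carrier : (Set.univ : Set M).Definable L carrier
  definable_rel : (Set.univ : Set M).Definable L
    {v : Fin n ⊕ Fin n → M | ∃ (h₁ : v ∘ Sum.inl ∈ carrier) (h₂ : v ∘ Sum.inr ∈ carrier),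
      setoid.r ⟨_, h₁⟩ ⟨_, h₂⟩}

variable {L : FirstOrder.Language.{u, v}} {M : Type w} [L.Structure M] {n m : ℕ}

namespace InterpretableSet

/-- The points of an interpretable set. -/
def Pt (X : InterpretableSet L M n) : Type w := Quotient X.setoid

/-- The tuple `v` is a representative of the point `x`. -/
def Rep (X : InterpretableSet L M n) (v : Fin n → M) (x : X.Pt) : Prop :=
  ∃ h : v ∈ X.carrier, (Quotient.mk X.setoid ⟨v, h⟩ : X.Pt) = x

/-- A subset of an interpretable set is definable if the set of all representatives of its elements
is definable. -/
def IsDefinableSubset (X : InterpretableSet L M n) (S : Set X.Pt) : Prop :=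
  (Set.univ : Set M).Definable L {v : Fin n → M | ∃ x ∈ S, X.Rep v x}

/-- A map between interpretable sets is interpretable if its graph is definable. -/
def IsInterpretableMap (X : InterpretableSet L M n) (Y : InterpretableSet L M m)
    (f : X.Pt → Y.Pt) : Prop :=
  (Set.univ : Set M).Definable L
    {v : Fin n ⊕ Fin m → M | ∃ x : X.Pt, X.Rep (v ∘ Sum.inl) x ∧ Y.Rep (v ∘ Sum.inr) (f x)}

/-- A definable subset of an interpretable set, as an interpretable set of its own. -/
def sub (X : InterpretableSet L M n) (S : Set X.Pt) (hS : X.IsDefinableSubset S) :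
    InterpretableSet L M n where
  carrier := {v | ∃ x ∈ S, X.Rep v x}
  setoid := X.setoid.comap fun v => ⟨v.1, v.2.choose_spec.2.choose⟩
  definable_carrier := hS
  definable_rel := by
    have h := (X.definable_rel.inter (hS.preimage_comp Sum.inl)).inter (hS.preimage_comp Sum.inr)
    convert h using 1
    ext v
    constructor
    · rintro ⟨h₁, h₂, h₃⟩
      exact ⟨⟨⟨_, _, h₃⟩, h₁⟩, h₂⟩
    · rintro ⟨⟨⟨_, _, h₃⟩, h₁⟩, h₂⟩
      exact ⟨h₁, h₂, h₃⟩

/-- The fibres of an interpretable map are definable. -/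
theorem IsInterpretableMap.fibre {X : InterpretableSet L M n} {Y : InterpretableSet L M m}
    {f : X.Pt → Y.Pt} (hf : X.IsInterpretableMap Y f) (y : Y.Pt) :
    X.IsDefinableSubset (f ⁻¹' {y}) := by
  obtain ⟨⟨b, hb⟩, rfl⟩ := Quotient.exists_rep y
  have h1 : (Set.univ : Set M).Definable L
      {v : Fin n ⊕ Fin m → M | ∀ i, v (Sum.inr i) = b i} := by
    have h0 : ∀ i : Fin m, (Set.univ : Set M).Definable L
        {v : Fin n ⊕ Fin m → M | v (Sum.inr i) = b i} := by
      intro i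
      have := (Set.Definable.singleton_of_mem (L := L) (Set.mem_univ (b i)))
      have h2 := Set.Definable.preimage_comp (fun _ : Fin 1 => (Sum.inr i : Fin n ⊕ Fin m)) this
      exact h2
    have := Set.definable_iInter_of_finite h0
    convert this using 1
    ext v
    simp
  have h2 := (Set.Definable.inter hf h1).image_comp (Sum.inl : Fin n → Fin n ⊕ Fin m)
  unfold IsDefinableSubset
  convert h2 using 1
  ext v
  constructor
  · rintro ⟨x, hx, hv⟩
    refine ⟨Sum.elim v b, ⟨⟨x, ?_, ?_⟩, fun i => rfl⟩, rfl⟩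
    · simpa using hv
    · refine ⟨hb, ?_⟩
      exact (show f x = _ from hx).symm
  · rintro ⟨z, ⟨⟨x, hx, hz⟩, hzb⟩, rfl⟩
    refine ⟨x, ?_, hx⟩
    have : z ∘ Sum.inr = b := funext hzb
    rw [this] at hz
    exact hz.choose_spec.symm

/-- The interpretable set is `φ(M, a)` modulo the relation `ε(x, x', a)`. -/
def IsDefinedBy (X : InterpretableSet L M n) (φ : L.Formula (Fin n ⊕ Fin m))
    (ε : L.Formula ((Fin n ⊕ Fin n) ⊕ Fin m)) (a : Fin m → M) : Prop :=
  (∀ x, x ∈ X.carrier ↔ φ.Realize (Sum.elim x a)) ∧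
  ∀ x x' : X.carrier, X.setoid.r x x' ↔ ε.Realize (Sum.elim (Sum.elim x.1 x'.1) a)

end InterpretableSet

/-- A dimension function on the interpretable sets in models of `T`, with values in
`ω ∪ {-∞}` (`⊥` is `-∞`). -/
structure DimensionFunction (T : L.Theory) where
  dim : ∀ (N : FirstOrder.Language.Theory.ModelType.{u, v, w} T) {n : ℕ}, InterpretableSet L N n → WithBot ℕ
  /-- Invariance: the dimension of an interpretable set depends only on the formulas that define it
  and on the type over `∅` of the parameters. -/
  invariance : ∀ (N : FirstOrder.Language.Theory.ModelType.{u, v, w} T) {n m : ℕ}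
    (φ : L.Formula (Fin n ⊕ Fin m)) (ε : L.Formula ((Fin n ⊕ Fin n) ⊕ Fin m)) (a a' : Fin m → N),
    T.typeOf a = T.typeOf a' → ∀ X X' : InterpretableSet L N n,
    X.IsDefinedBy φ ε a → X'.IsDefinedBy φ ε a' → dim N X = dim N X'
  /-- Algebraicity, for the empty set. -/
  dim_empty : ∀ (N : FirstOrder.Language.Theory.ModelType.{u, v, w} T) {n : ℕ} (X : InterpretableSet L N n),
    IsEmpty X.Pt → dim N X = ⊥
  /-- Algebraicity, for nonempty sets. -/
  dim_eq_zero : ∀ (N : FirstOrder.Language.Theory.ModelType.{u, v, w} T) {n : ℕ} (X : InterpretableSet L N n),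
    Nonempty X.Pt → (dim N X = 0 ↔ Finite X.Pt)
  /-- Union. -/
  union : ∀ (N : FirstOrder.Language.Theory.ModelType.{u, v, w} T) {n : ℕ} (Z : InterpretableSet L N n)
    (S S' : Set Z.Pt) (hS : Z.IsDefinableSubset S) (hS' : Z.IsDefinableSubset S')
    (hu : Z.IsDefinableSubset (S ∪ S')),
    dim N (Z.sub (S ∪ S') hu) = max (dim N (Z.sub S hS)) (dim N (Z.sub S' hS'))
  /-- Upper fibration. -/
  upper_fibration : ∀ (N : FirstOrder.Language.Theory.ModelType.{u, v, w} T) {n m : ℕ}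
    (X : InterpretableSet L N n) (Y : InterpretableSet L N m) (f : X.Pt → Y.Pt)
    (hf : X.IsInterpretableMap Y f) (k : ℕ),
    (∀ y : Y.Pt, (k : WithBot ℕ) ≤ dim N (X.sub (f ⁻¹' {y}) (hf.fibre y))) →
    dim N Y + k ≤ dim N X
  /-- Lower fibration. -/
  lower_fibration : ∀ (N : FirstOrder.Language.Theory.ModelType.{u, v, w} T) {n m : ℕ}
    (X : InterpretableSet L N n) (Y : InterpretableSet L N m) (f : X.Pt → Y.Pt)
    (hf : X.IsInterpretableMap Y f) (k : ℕ),
    (∀ y : Y.Pt, dim N (X.sub (f ⁻¹' {y}) (hf.fibre y)) ≤ (k : WithBot ℕ)) →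
    dim N X ≤ dim N Y + k

/-- `T` is a finite-dimensional theory. The models of `T` range over the universe `w`. -/
def IsFiniteDimensional (T : L.Theory) : Prop :=
  Nonempty (DimensionFunction.{u, v, w} T)

end Interpretable

/-! ### Definable Lie rings and modules -/

section DefinableModules

/-- An identification of `X` with an interpretable set of `M`. -/
structure Coordinates (L : FirstOrder.Language.{u, v}) (M : Type w) [L.Structure M] (X : Type*) where
  n : ℕ
  set : InterpretableSet L M n
  equiv : set.Pt ≃ X

variable {L : FirstOrder.Language.{u, v}} {M : Type w} [L.Structure M]

/-- The tuple `v` represents the element `x`. -/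
def Coordinates.Rep {X : Type*} (c : Coordinates L M X) (v : Fin c.n → M) (x : X) : Prop :=
  c.set.Rep v (c.equiv.symm x)

/-- The subset `S` of `X` is definable (with parameters). -/
def Coordinates.IsDefinable {X : Type*} (c : Coordinates L M X) (S : Set X) : Prop :=
  (Set.univ : Set M).Definable L {v : Fin c.n → M | ∃ x ∈ S, c.Rep v x}

/-- The operation `op : X × Y → Z` is definable (with parameters), i.e. it has a definable graph. -/
def IsDefinableOperation {X Y Z : Type*} (cX : Coordinates L M X) (cY : Coordinates L M Y)
    (cZ : Coordinates L M Z) (op : X → Y → Z) : Prop :=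
  (Set.univ : Set M).Definable L
    {v : Fin cX.n ⊕ Fin cY.n ⊕ Fin cZ.n → M | ∃ (x : X) (y : Y),
      cX.Rep (v ∘ Sum.inl) x ∧ cY.Rep (v ∘ Sum.inr ∘ Sum.inl) y ∧
      cZ.Rep (v ∘ Sum.inr ∘ Sum.inr) (op x y)}

/-- The `𝔤`-module `A` is definable in `M`: the Lie ring `𝔤`, the abelian group `A` and the
action are definable in `M`. As usual when quotients by definable subgroups are formed,
"definable" allows quotients of definable sets by definable equivalence relations. -/
structure DefinableModule (L : FirstOrder.Language.{u, v}) (M : Type w) [L.Structure M]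
    (𝔤 A : Type*) [LieRing 𝔤] [AddCommGroup A] [LieRingModule 𝔤 A] where
  coordLie : Coordinates L M 𝔤
  coordModule : Coordinates L M A
  add_lie_definable : IsDefinableOperation coordLie coordLie coordLie (fun x y : 𝔤 => x + y)
  bracket_definable : IsDefinableOperation coordLie coordLie coordLie (fun x y : 𝔤 => ⁅x, y⁆)
  add_module_definable :
    IsDefinableOperation coordModule coordModule coordModule (fun a b : A => a + b)
  action_definable : IsDefinableOperation coordLie coordModule coordModule
    (fun (x : 𝔤) (a : A) => ⁅x, a⁆)

end DefinableModules

/-! ### Almost containment, isogenies, almost centralisers -/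

section Almost

/-- `H` is almost contained in `K`: `H ∩ K` has finite index in `H`. -/
def AlmostLE {G : Type*} [AddGroup G] (H K : AddSubgroup G) : Prop :=
  K.IsFiniteRelIndex H

/-- The abelian groups `G` and `H` are isogenous: there are subgroups of finite index `B` of `G` and
`C` of `H`, and finite subgroups `B₁` of `B` and `C₁` of `C`, such that `B ⧸ B₁ ≃ C ⧸ C₁`. -/
def Isogenous (G H : Type*) [AddCommGroup G] [AddCommGroup H] : Prop :=
  ∃ (B : AddSubgroup G) (C : AddSubgroup H) (B₁ : AddSubgroup B) (C₁ : AddSubgroup C),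
    B.FiniteIndex ∧ C.FiniteIndex ∧ Finite B₁ ∧ Finite C₁ ∧ Nonempty ((B ⧸ B₁) ≃+ (C ⧸ C₁))

variable {𝔤 V : Type*} [LieRing 𝔤] [AddCommGroup V] [LieRingModule 𝔤 V]

/-- Acting by `g`, as an endomorphism of `V`. -/
def actLeft (g : 𝔤) : V →+ V where
  toFun v := ⁅g, v⁆
  map_zero' := lie_zero g
  map_add' := lie_add g

/-- Acting on `v`, as a homomorphism from `𝔤` to `V`. This is the inner derivation of `v`. -/
def actRight (v : V) : 𝔤 →+ V where
  toFun g := ⁅g, v⁆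
  map_zero' := zero_lie v
  map_add' g h := add_lie g h v

/-- The almost centraliser of `B` in `𝔤` over `A`: the set of `g` such that `g · B` is almost
contained in `A`. -/
def almostCentralizerLie (𝔤 : Type*) {V : Type*} [LieRing 𝔤] [AddCommGroup V] [LieRingModule 𝔤 V]
    (B A : AddSubgroup V) : Set 𝔤 :=
  {g | AlmostLE (B.map (actLeft g)) A}

/-- The almost centraliser of `H` in `V` over `A`: the set of `v` such that `H · v` is almost
contained in `A`. -/
def almostCentralizerModule (H : AddSubgroup 𝔤) (A : AddSubgroup V) : Set V :=
  {v | AlmostLE (H.map (actRight v)) A}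

/-- The almost centre of `𝔤`: the almost centraliser of `𝔤` for the adjoint action. -/
def almostCenter (𝔤 : Type*) [LieRing 𝔤] : Set 𝔤 :=
  almostCentralizerLie 𝔤 (⊤ : AddSubgroup 𝔤) ⊥

end Almost

/-! ### Partial homomorphisms up to finite error -/

/-- A partial homomorphism from `G` to `H`: a homomorphism to `H` from a subgroup of finite index
of `G`. -/
structure PartialHom (G H : Type*) [AddCommGroup G] [AddCommGroup H] where
  dom : AddSubgroup G
  finiteIndex : dom.FiniteIndex
  toHom : dom →+ H

namespace PartialHom

variable {G H : Type*} [AddCommGroup G] [AddCommGroup H]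

/-- A homomorphism that is defined everywhere. -/
def ofHom (f : G →+ H) : PartialHom G H where
  dom := ⊤
  finiteIndex := inferInstance
  toHom := f.comp (AddSubgroup.subtype ⊤)

instance : Zero (PartialHom G H) := ⟨ofHom 0⟩

instance : Neg (PartialHom G H) := ⟨fun f => ⟨f.dom, f.finiteIndex, -f.toHom⟩⟩

instance : Add (PartialHom G H) :=
  ⟨fun f f' =>
    { dom := f.dom ⊓ f'.dom
      finiteIndex := by
        have := f.finiteIndex
        have := f'.finiteIndex
        infer_instance
      toHom := f.toHom.comp (AddSubgroup.inclusion inf_le_left) +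
        f'.toHom.comp (AddSubgroup.inclusion inf_le_right) }⟩

instance : Sub (PartialHom G H) := ⟨fun f f' => f + -f'⟩

/-- `f ∼ f'` if `f - f'` has finite image. -/
def Equivalent (f f' : PartialHom G H) : Prop :=
  (Set.range (f - f').toHom).Finite

/-- Two partial homomorphisms are equivalent iff they agree on a subgroup of finite index. -/
theorem equivalent_iff {f f' : PartialHom G H} : f.Equivalent f' ↔
    ∃ K : AddSubgroup G, K.FiniteIndex ∧ ∃ (h : K ≤ f.dom) (h' : K ≤ f'.dom),
      ∀ x (hx : x ∈ K), f.toHom ⟨x, h hx⟩ = f'.toHom ⟨x, h' hx⟩ := by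
  constructor
  · intro hf
    have hfin := (f - f').finiteIndex
    have : Finite (f - f').toHom.range := hf
    have hk : (f - f').toHom.ker.FiniteIndex := inferInstance
    have hle : (f - f').toHom.ker.map (f - f').dom.subtype ≤ f.dom ⊓ f'.dom := by
      rintro _ ⟨x, -, rfl⟩
      exact x.2
    refine ⟨(f - f').toHom.ker.map (f - f').dom.subtype, ⟨?_⟩, hle.trans inf_le_left,
      hle.trans inf_le_right, ?_⟩
    · rw [AddSubgroup.index_map_subtype]
      exact mul_ne_zero hk.index_ne_zero hfin.index_ne_zero
    · rintro _ ⟨x, hx, rfl⟩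
      have : (f - f').toHom x = 0 := hx
      have h2 : f.toHom (AddSubgroup.inclusion inf_le_left x) +
        -f'.toHom (AddSubgroup.inclusion inf_le_right x) = 0 := this
      rw [add_neg_eq_zero] at h2
      exact h2
  · rintro ⟨K, hK, h, h', hKeq⟩
    have hle : K.addSubgroupOf (f - f').dom ≤ (f - f').toHom.ker := by
      intro x hx
      have hx' : (x : G) ∈ K := hx
      have := hKeq x hx'
      change f.toHom (AddSubgroup.inclusion inf_le_left x) +
        -f'.toHom (AddSubgroup.inclusion inf_le_right x) = 0
      rw [add_neg_eq_zero]
      exact this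
    have : (f - f').toHom.ker.FiniteIndex := AddSubgroup.finiteIndex_of_le hle
    have h3 : Finite (_ ⧸ (f - f').toHom.ker) := AddSubgroup.finite_quotient_of_finiteIndex
    have h4 : Finite (f - f').toHom.range :=
      Finite.of_equiv _ (QuotientAddGroup.quotientKerEquivRange (f - f').toHom).toEquiv
    exact h4

instance setoid (G H : Type*) [AddCommGroup G] [AddCommGroup H] : Setoid (PartialHom G H) where
  r := Equivalent
  iseqv :=
    { refl := fun f => equivalent_iff.2 ⟨f.dom, f.finiteIndex, le_rfl, le_rfl, fun _ _ => rfl⟩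
      symm := fun h => by
        obtain ⟨K, hK, h1, h2, h3⟩ := equivalent_iff.1 h
        exact equivalent_iff.2 ⟨K, hK, h2, h1, fun x hx => (h3 x hx).symm⟩
      trans := fun h h' => by
        obtain ⟨K, hK, h1, h2, h3⟩ := equivalent_iff.1 h
        obtain ⟨K', hK', h1', h2', h3'⟩ := equivalent_iff.1 h'
        exact equivalent_iff.2 ⟨K ⊓ K', inferInstance, inf_le_left.trans h1, inf_le_right.trans h2',
          fun x hx => (h3 x hx.1).trans (h3' x hx.2)⟩ }

theorem mk_eq_mk {f f' : PartialHom G H} : (⟦f⟧ : Quotient (setoid G H)) = ⟦f'⟧ ↔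
    ∃ K : AddSubgroup G, K.FiniteIndex ∧ ∃ (h : K ≤ f.dom) (h' : K ≤ f'.dom),
      ∀ x (hx : x ∈ K), f.toHom ⟨x, h hx⟩ = f'.toHom ⟨x, h' hx⟩ :=
  Quotient.eq.trans equivalent_iff

end PartialHom

/-- Partial homomorphisms from `G` to `H` modulo equivalence. For `G` a Lie ring and `H` a module,
this is the group of almost `1`-cochains. -/
def PartialHomClass (G H : Type*) [AddCommGroup G] [AddCommGroup H] : Type _ :=
  Quotient (PartialHom.setoid G H)

namespace PartialHomClass

variable {G H : Type*} [AddCommGroup G] [AddCommGroup H]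

/-- The class of a partial homomorphism. -/
def mk (f : PartialHom G H) : PartialHomClass G H := Quotient.mk (PartialHom.setoid G H) f

instance : Zero (PartialHomClass G H) := ⟨mk 0⟩

instance : Neg (PartialHomClass G H) :=
  ⟨Quotient.map (fun f => -f) fun f f' h => by
    obtain ⟨K, hK, h1, h2, h3⟩ := PartialHom.equivalent_iff.1 h
    exact PartialHom.equivalent_iff.2 ⟨K, hK, h1, h2, fun x hx => congrArg (fun y => -y) (h3 x hx)⟩⟩

instance : Add (PartialHomClass G H) :=
  ⟨Quotient.map₂ (fun f f' => f + f') fun f₁ f₁' h f₂ f₂' h' => by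
    obtain ⟨K, hK, h1, h2, h3⟩ := PartialHom.equivalent_iff.1 h
    obtain ⟨K', hK', h1', h2', h3'⟩ := PartialHom.equivalent_iff.1 h'
    exact PartialHom.equivalent_iff.2 ⟨K ⊓ K', inferInstance, inf_le_inf h1 h1', inf_le_inf h2 h2',
      fun x hx => congrArg₂ (fun y z => y + z) (h3 x hx.1) (h3' x hx.2)⟩⟩

theorem mk_eq_mk {f f' : PartialHom G H} : mk f = mk f' ↔
    ∃ K : AddSubgroup G, K.FiniteIndex ∧ ∃ (h : K ≤ f.dom) (h' : K ≤ f'.dom),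
      ∀ x (hx : x ∈ K), f.toHom ⟨x, h hx⟩ = f'.toHom ⟨x, h' hx⟩ :=
  PartialHom.mk_eq_mk

instance : AddCommGroup (PartialHomClass G H) where
  add_assoc := by
    rintro ⟨f⟩ ⟨f'⟩ ⟨f''⟩
    exact mk_eq_mk.2 ⟨_, (f + f' + f'').finiteIndex, le_rfl, le_of_eq (inf_assoc _ _ _),
      fun x hx => add_assoc _ _ _⟩
  zero_add := by
    rintro ⟨f⟩
    exact mk_eq_mk.2 ⟨_, f.finiteIndex, le_inf le_top le_rfl, le_rfl, fun x hx => zero_add _⟩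
  add_zero := by
    rintro ⟨f⟩
    exact mk_eq_mk.2 ⟨_, f.finiteIndex, le_inf le_rfl le_top, le_rfl, fun x hx => add_zero _⟩
  add_comm := by
    rintro ⟨f⟩ ⟨f'⟩
    exact mk_eq_mk.2 ⟨_, (f + f').finiteIndex, le_rfl, le_of_eq (inf_comm _ _), fun x hx => add_comm _ _⟩
  neg_add_cancel := by
    rintro ⟨f⟩
    exact mk_eq_mk.2 ⟨_, f.finiteIndex, le_inf le_rfl le_rfl, le_top, fun x hx => neg_add_cancel _⟩
  nsmul := nsmulRec
  zsmul := zsmulRec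

end PartialHomClass

/-! ### Almost derivations and the first almost cohomology group -/

section Cohomology

variable {𝔤 A : Type*} [LieRing 𝔤] [AddCommGroup A] [LieRingModule 𝔤 A]

/-- The subgroup of all `g'` in `Dom f` with `[g, g']` in `Dom f` and
`f [g, g'] = g (f g') - g' (f g)`. -/
def derivationDomainAt (f : PartialHom 𝔤 A) (g : f.dom) : AddSubgroup 𝔤 where
  carrier := {g' | ∃ (h : g' ∈ f.dom) (h' : ⁅(g : 𝔤), g'⁆ ∈ f.dom),
    f.toHom ⟨⁅(g : 𝔤), g'⁆, h'⟩ = ⁅(g : 𝔤), f.toHom ⟨g', h⟩⁆ - ⁅g', f.toHom g⁆}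
  zero_mem' := by
    refine ⟨zero_mem _, by rw [lie_zero]; exact zero_mem _, ?_⟩
    have h1 : (⟨⁅(g : 𝔤), (0 : 𝔤)⁆, by rw [lie_zero]; exact zero_mem _⟩ : f.dom) = 0 :=
      Subtype.ext (lie_zero _)
    have h2 : (⟨0, zero_mem _⟩ : f.dom) = 0 := rfl
    rw [h1, h2, map_zero, lie_zero, zero_lie, sub_zero]
  add_mem' := by
    rintro x y ⟨hx, hx', ex⟩ ⟨hy, hy', ey⟩
    have hxy : ⁅(g : 𝔤), x + y⁆ ∈ f.dom := by
      rw [lie_add]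
      exact add_mem hx' hy'
    refine ⟨add_mem hx hy, hxy, ?_⟩
    have h1 : (⟨⁅(g : 𝔤), x + y⁆, hxy⟩ : f.dom) = ⟨_, hx'⟩ + ⟨_, hy'⟩ := Subtype.ext (lie_add _ _ _)
    have h2 : (⟨x + y, add_mem hx hy⟩ : f.dom) = ⟨_, hx⟩ + ⟨_, hy⟩ := rfl
    rw [h1, h2, map_add, map_add, ex, ey, lie_add, add_lie]
    abel
  neg_mem' := by
    rintro x ⟨hx, hx', ex⟩
    have hx'' : ⁅(g : 𝔤), -x⁆ ∈ f.dom := by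
      rw [lie_neg]
      exact neg_mem hx'
    refine ⟨neg_mem hx, hx'', ?_⟩
    have h1 : (⟨⁅(g : 𝔤), -x⁆, hx''⟩ : f.dom) = -⟨_, hx'⟩ := Subtype.ext (lie_neg _ _)
    have h2 : (⟨-x, neg_mem hx⟩ : f.dom) = -⟨_, hx⟩ := rfl
    rw [h1, h2, map_neg, map_neg, ex, lie_neg, neg_lie]
    abel

/-- The subgroup of all `g` in `Dom f` for which the previous subgroup is commensurable to `𝔤`. -/
def derivationDomain (f : PartialHom 𝔤 A) : AddSubgroup 𝔤 where
  carrier := {g | ∃ h : g ∈ f.dom, (derivationDomainAt f ⟨g, h⟩).Commensurable ⊤}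
  zero_mem' := by
    refine ⟨zero_mem _, ?_⟩
    have hfin := f.finiteIndex
    have hle : f.dom ≤ derivationDomainAt f ⟨0, zero_mem _⟩ := by
      intro x hx
      have h0 : ⁅(0 : 𝔤), x⁆ ∈ f.dom := by
        rw [zero_lie]
        exact zero_mem _
      refine ⟨hx, h0, ?_⟩
      have h1 : (⟨⁅(0 : 𝔤), x⁆, h0⟩ : f.dom) = 0 := Subtype.ext (zero_lie _)
      change f.toHom ⟨⁅(0 : 𝔤), x⁆, h0⟩ = ⁅(0 : 𝔤), f.toHom ⟨x, hx⟩⁆ - ⁅x, f.toHom 0⁆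
      rw [h1, map_zero, zero_lie, lie_zero, sub_zero]
    have := AddSubgroup.finiteIndex_of_le hle
    refine ⟨?_, ?_⟩
    · simpa using this.index_ne_zero
    · simp
  add_mem' := by
    rintro x y ⟨hx, hx'⟩ ⟨hy, hy'⟩
    refine ⟨add_mem hx hy, ?_⟩
    have fx : (derivationDomainAt f ⟨x, hx⟩).FiniteIndex := ⟨by simpa using hx'.1⟩
    have fy : (derivationDomainAt f ⟨y, hy⟩).FiniteIndex := ⟨by simpa using hy'.1⟩
    have hle : derivationDomainAt f ⟨x, hx⟩ ⊓ derivationDomainAt f ⟨y, hy⟩ ≤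
        derivationDomainAt f ⟨x + y, add_mem hx hy⟩ := by
      rintro z ⟨⟨hz, hxz, ex⟩, ⟨_, hyz, ey⟩⟩
      have hxyz : ⁅x + y, z⁆ ∈ f.dom := by
        rw [add_lie]
        exact add_mem hxz hyz
      refine ⟨hz, hxyz, ?_⟩
      have h1 : (⟨⁅x + y, z⁆, hxyz⟩ : f.dom) = ⟨_, hxz⟩ + ⟨_, hyz⟩ := Subtype.ext (add_lie _ _ _)
      change f.toHom ⟨⁅x + y, z⁆, hxyz⟩ = ⁅x + y, f.toHom ⟨z, hz⟩⁆ -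
        ⁅z, f.toHom (⟨x, hx⟩ + ⟨y, hy⟩)⁆
      rw [h1, map_add, map_add, ex, ey, lie_add, add_lie]
      abel
    have := AddSubgroup.finiteIndex_of_le hle
    refine ⟨?_, ?_⟩
    · simpa using this.index_ne_zero
    · simp
  neg_mem' := by
    rintro x ⟨hx, hx'⟩
    refine ⟨neg_mem hx, ?_⟩
    have fx : (derivationDomainAt f ⟨x, hx⟩).FiniteIndex := ⟨by simpa using hx'.1⟩
    have hle : derivationDomainAt f ⟨x, hx⟩ ≤ derivationDomainAt f ⟨-x, neg_mem hx⟩ := by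
      rintro z ⟨hz, hxz, ex⟩
      have hxyz : ⁅-x, z⁆ ∈ f.dom := by
        rw [neg_lie]
        exact neg_mem hxz
      refine ⟨hz, hxyz, ?_⟩
      have h1 : (⟨⁅-x, z⁆, hxyz⟩ : f.dom) = -⟨_, hxz⟩ := Subtype.ext (neg_lie _ _)
      change f.toHom ⟨⁅-x, z⁆, hxyz⟩ = ⁅-x, f.toHom ⟨z, hz⟩⁆ - ⁅z, f.toHom (-⟨x, hx⟩)⁆
      rw [h1, map_neg, map_neg, ex, lie_neg, neg_lie]
      abel
    have := AddSubgroup.finiteIndex_of_le hle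
    refine ⟨?_, ?_⟩
    · simpa using this.index_ne_zero
    · simp

/-- `f` is an almost derivation. -/
def IsAlmostDerivation (f : PartialHom 𝔤 A) : Prop :=
  (derivationDomain f).FiniteIndex

theorem mem_derivationDomain {f : PartialHom 𝔤 A} {g : 𝔤} :
    g ∈ derivationDomain f ↔ ∃ h : g ∈ f.dom, (derivationDomainAt f ⟨g, h⟩).FiniteIndex := by
  refine exists_congr fun h => ⟨fun hc => ⟨by simpa using hc.1⟩, fun hc => ⟨?_, ?_⟩⟩
  · simpa using hc.index_ne_zero
  · simp

/-- The group of classes of almost derivations. -/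
def almostDer (𝔤 A : Type*) [LieRing 𝔤] [AddCommGroup A] [LieRingModule 𝔤 A] :
    AddSubgroup (PartialHomClass 𝔤 A) where
  carrier := {c | ∃ f : PartialHom 𝔤 A, IsAlmostDerivation f ∧ PartialHomClass.mk f = c}
  zero_mem' := by
    refine ⟨0, ?_, rfl⟩
    have : derivationDomain (0 : PartialHom 𝔤 A) = ⊤ := by
      refine eq_top_iff.2 fun g _ => mem_derivationDomain.2 ⟨trivial, ?_⟩
      have : derivationDomainAt (0 : PartialHom 𝔤 A) ⟨g, trivial⟩ = ⊤ := by
        refine eq_top_iff.2 fun g' _ => ⟨trivial, trivial, ?_⟩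
        change (0 : A) = ⁅g, (0 : A)⁆ - ⁅g', (0 : A)⁆
        simp
      rw [this]
      infer_instance
    rw [IsAlmostDerivation, this]
    infer_instance
  add_mem' := by
    rintro _ _ ⟨f, hf, rfl⟩ ⟨f', hf', rfl⟩
    refine ⟨f + f', ?_, rfl⟩
    have : (derivationDomain f).FiniteIndex := hf
    have : (derivationDomain f').FiniteIndex := hf'
    refine AddSubgroup.finiteIndex_of_le (H := derivationDomain f ⊓ derivationDomain f') ?_
    rintro g ⟨hg, hg'⟩
    obtain ⟨h1, h2⟩ := mem_derivationDomain.1 hg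
    obtain ⟨h1', h2'⟩ := mem_derivationDomain.1 hg'
    refine mem_derivationDomain.2 ⟨⟨h1, h1'⟩, ?_⟩
    refine AddSubgroup.finiteIndex_of_le
      (H := derivationDomainAt f ⟨g, h1⟩ ⊓ derivationDomainAt f' ⟨g, h1'⟩) ?_
    rintro x ⟨⟨a1, a2, a3⟩, ⟨b1, b2, b3⟩⟩
    refine ⟨⟨a1, b1⟩, ⟨a2, b2⟩, ?_⟩
    change f.toHom ⟨_, a2⟩ + f'.toHom ⟨_, b2⟩ = ⁅g, f.toHom ⟨x, a1⟩ + f'.toHom ⟨x, b1⟩⁆ -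
      ⁅x, f.toHom ⟨g, h1⟩ + f'.toHom ⟨g, h1'⟩⁆
    rw [a3, b3, lie_add, lie_add]
    abel
  neg_mem' := by
    rintro _ ⟨f, hf, rfl⟩
    refine ⟨-f, ?_, rfl⟩
    have : (derivationDomain f).FiniteIndex := hf
    refine AddSubgroup.finiteIndex_of_le (H := derivationDomain f) ?_
    intro g hg
    obtain ⟨h1, h2⟩ := mem_derivationDomain.1 hg
    refine mem_derivationDomain.2 ⟨h1, ?_⟩
    refine AddSubgroup.finiteIndex_of_le (H := derivationDomainAt f ⟨g, h1⟩) ?_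
    rintro x ⟨a1, a2, a3⟩
    refine ⟨a1, a2, ?_⟩
    change -f.toHom ⟨_, a2⟩ = ⁅g, -f.toHom ⟨x, a1⟩⁆ - ⁅x, -f.toHom ⟨g, h1⟩⁆
    rw [a3, lie_neg, lie_neg]
    abel

/-- The differential, which sends `a` to the class of the inner derivation `g ↦ g · a`. -/
def differential (𝔤 A : Type*) [LieRing 𝔤] [AddCommGroup A] [LieRingModule 𝔤 A] :
    A →+ PartialHomClass 𝔤 A where
  toFun a := PartialHomClass.mk (PartialHom.ofHom (actRight a))
  map_zero' := PartialHomClass.mk_eq_mk.2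
    ⟨⊤, inferInstance, le_rfl, le_rfl, fun x _ => lie_zero (x : 𝔤)⟩
  map_add' a b := PartialHomClass.mk_eq_mk.2
    ⟨⊤, inferInstance, le_rfl, le_inf le_rfl le_rfl, fun x _ => lie_add (x : 𝔤) a b⟩

/-- Inner derivations are almost derivations. -/
theorem range_differential_le (𝔤 A : Type*) [LieRing 𝔤] [AddCommGroup A] [LieRingModule 𝔤 A] :
    (differential 𝔤 A).range ≤ almostDer 𝔤 A := by
  rintro _ ⟨a, rfl⟩
  refine ⟨PartialHom.ofHom (actRight a), ?_, rfl⟩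
  refine AddSubgroup.finiteIndex_of_le (H := ⊤) fun g _ => mem_derivationDomain.2 ⟨trivial, ?_⟩
  refine AddSubgroup.finiteIndex_of_le (H := ⊤) fun x _ => ⟨trivial, trivial, ?_⟩
  change ⁅⁅g, x⁆, a⁆ = ⁅g, ⁅x, a⁆⁆ - ⁅x, ⁅g, a⁆⁆
  exact lie_lie g x a

/-- The first almost cohomology group: almost derivations modulo the image of the differential
(which consists of almost derivations). -/
abbrev AlmostH1 (𝔤 A : Type*) [LieRing 𝔤] [AddCommGroup A] [LieRingModule 𝔤 A] : Type _ :=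
  almostDer 𝔤 A ⧸ (differential 𝔤 A).range.addSubgroupOf (almostDer 𝔤 A)

/-- If the ideal `𝔥` acts trivially on `A`, then `𝔤 ⧸ 𝔥` acts on `A` by `(x + 𝔥) · a = x · a`. -/
abbrev quotientModule (𝔥 : LieIdeal ℤ 𝔤) (htriv : ∀ x ∈ 𝔥, ∀ a : A, ⁅x, a⁆ = 0) :
    LieRingModule (𝔤 ⧸ 𝔥) A where
  bracket q a := Quotient.liftOn' q (fun x => ⁅x, a⁆) fun x y hxy => by
    have hm : x - y ∈ 𝔥 := (Submodule.quotientRel_def 𝔥.toSubmodule).1 hxy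
    have := htriv _ hm a
    rwa [sub_lie, sub_eq_zero] at this
  add_lie := by
    rintro ⟨x⟩ ⟨y⟩ a
    exact add_lie x y a
  lie_add := by
    rintro ⟨x⟩ a b
    exact lie_add x a b
  leibniz_lie := by
    rintro ⟨x⟩ ⟨y⟩ a
    exact leibniz_lie x y a

end Cohomology

end AlmostCohomology

namespace AlmostCohomology

/-! Two computations show that triviality of the almost centraliser of `𝔤` in `A` makes `𝔥`
invisible to the cohomology. Let `h ∈ 𝔥`, so that `h · A` and `[h, 𝔤]` are finite.

Action: `g · (h · a) = h · (g · a) - [h, g] · a` takes finitely many values as `g` varies, so `h ·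
a` lies in the almost centraliser and is `0` (`lie_eq_zero_of_almost_central`).

Almost derivations: let `f` be one and let `h` also lie in `D^f`. For `g ∈ D^f_h` the derivation
rule reads `f [h, g] = -g · f h`, since `h` acts trivially. The left side takes finitely many values
and `D^f_h` has finite index, so `𝔤 · f h` is finite and `f h = 0`
(`toHom_eq_zero_of_mem_derivationDomain`).

Hence `f` restricted to `D^f` descends to the image of `D^f` in `𝔤 ⧸ 𝔥`. Inflation, which is
composition with the quotient map, is therefore onto the classes of almost derivations
(`map_comap_almostDer`). It is injective because images of finite-index subgroups under a surjection
have finite index, and it matches inner derivations with inner derivations. The two cohomology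
groups are thus isomorphic, which is stronger than isogenous. -/

theorem Isogenous.of_addEquiv {G H : Type*} [AddCommGroup G] [AddCommGroup H] (e : G ≃+ H) :
    Isogenous G H := by
  refine ⟨⊤, ⊤, ⊥, ⊥, inferInstance, inferInstance, inferInstance, inferInstance, ⟨?_⟩⟩
  exact QuotientAddGroup.quotientBot.trans <| AddSubgroup.topEquiv.trans <| e.trans <|
    AddSubgroup.topEquiv.symm.trans QuotientAddGroup.quotientBot.symm

/-! ### Finite subgroups and subgroups of finite index -/

section Groups

variable {G H : Type*} [AddCommGroup G] [AddCommGroup H]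

/-- The relative index of `⊥` in `K` is `Nat.card K`, whose default value `0` marks exactly the
infinite subgroups. -/
theorem almostLE_bot_iff {K : AddSubgroup G} : AlmostLE K ⊥ ↔ (K : Set G).Finite := by
  rw [AlmostLE, AddSubgroup.isFiniteRelIndex_iff_relIndex_ne_zero, AddSubgroup.relIndex_bot_left]
  exact ⟨fun h => Nat.finite_of_card_ne_zero h, fun h => by
    have : Finite K := h
    exact Nat.card_pos.ne'⟩

/-- A homomorphism that has finite image on a subgroup of finite index has finite image. -/
theorem finite_range_of_finite_image (f : G →+ H) {K : AddSubgroup G} (hK : K.FiniteIndex)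
    (h : (f '' K).Finite) : (Set.range f).Finite := by
  have h1 : (Set.range (f.comp K.subtype)).Finite := by
    refine h.subset ?_
    rintro _ ⟨x, rfl⟩
    exact ⟨x, x.2, rfl⟩
  have h2 : Finite (f.comp K.subtype).range := h1
  have h3 : (f.comp K.subtype).ker.FiniteIndex := inferInstance
  -- Indices multiply along `ker (f|K) ≤ K ≤ G`, and `ker f` contains `ker (f|K)`.
  have h4 : ((f.comp K.subtype).ker.map K.subtype).FiniteIndex := by
    refine ⟨?_⟩
    rw [AddSubgroup.index_map_subtype]
    exact mul_ne_zero h3.index_ne_zero hK.index_ne_zero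
  have h5 : f.ker.FiniteIndex := by
    refine AddSubgroup.finiteIndex_of_le (H := (f.comp K.subtype).ker.map K.subtype) ?_
    rintro _ ⟨x, hx, rfl⟩
    exact hx
  have h6 : Finite (G ⧸ f.ker) := AddSubgroup.finite_quotient_of_finiteIndex
  have h7 : Finite f.range :=
    Finite.of_equiv _ (QuotientAddGroup.quotientKerEquivRange f).toEquiv
  exact h7

theorem finiteIndex_comap {K : AddSubgroup H} (hK : K.FiniteIndex) (φ : G →+ H) :
    (K.comap φ).FiniteIndex := by
  refine ⟨?_⟩
  -- The preimage has index equal to the relative index of `K` in the range of `φ`, which divides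
  -- the index of `K`.
  rw [AddSubgroup.index_comap]
  exact ne_zero_of_dvd_ne_zero hK.index_ne_zero (AddSubgroup.relIndex_dvd_index_of_normal _ _)

theorem finiteIndex_map {K : AddSubgroup G} (hK : K.FiniteIndex) {φ : G →+ H}
    (hφ : Function.Surjective φ) : (K.map φ).FiniteIndex :=
  ⟨ne_zero_of_dvd_ne_zero hK.index_ne_zero (K.index_map_dvd hφ)⟩

end Groups

/-! ### Pulling back partial homomorphisms -/

section Comap

variable {G G' H : Type*} [AddCommGroup G] [AddCommGroup G'] [AddCommGroup H]

/-- The composite of a partial homomorphism with a homomorphism that is defined everywhere. -/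
def PartialHom.comap (φ : G →+ G') (f : PartialHom G' H) : PartialHom G H where
  dom := f.dom.comap φ
  finiteIndex := finiteIndex_comap f.finiteIndex φ
  toHom := f.toHom.comp (φ.addSubgroupComap f.dom)

/-- Composition with a homomorphism, on classes of partial homomorphisms. -/
def PartialHomClass.comap (φ : G →+ G') : PartialHomClass G' H →+ PartialHomClass G H where
  toFun := Quotient.map (PartialHom.comap φ) fun f f' h => by
    obtain ⟨K, hK, h1, h2, h3⟩ := PartialHom.equivalent_iff.1 h
    exact PartialHom.equivalent_iff.2 ⟨K.comap φ, finiteIndex_comap hK φ,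
      AddSubgroup.comap_mono h1, AddSubgroup.comap_mono h2, fun x hx => h3 _ hx⟩
  map_zero' := mk_eq_mk.2 ⟨⊤, inferInstance, fun _ _ => trivial, le_rfl, fun _ _ => rfl⟩
  map_add' := by
    rintro ⟨f⟩ ⟨f'⟩
    exact mk_eq_mk.2 ⟨_, finiteIndex_comap (f + f').finiteIndex φ, le_rfl, le_rfl, fun _ _ => rfl⟩

/-- If the pullbacks agree on `K`, the original maps agree on `φ(K)`, which has finite index by
surjectivity. -/
theorem PartialHomClass.comap_injective {φ : G →+ G'} (hφ : Function.Surjective φ) :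
    Function.Injective (PartialHomClass.comap (H := H) φ) := by
  rintro ⟨f⟩ ⟨f'⟩ h
  obtain ⟨K, hK, h1, h2, h3⟩ := mk_eq_mk.1 h
  refine mk_eq_mk.2 ⟨K.map φ, finiteIndex_map hK hφ, AddSubgroup.map_le_iff_le_comap.2 h1,
    AddSubgroup.map_le_iff_le_comap.2 h2, ?_⟩
  rintro _ ⟨x, hx, rfl⟩
  exact h3 x hx

end Comap

/-! ### Vanishing forced by the trivial almost centraliser -/

section Inflation

variable {𝔤 A : Type*} [LieRing 𝔤] [AddCommGroup A] [LieRingModule 𝔤 A]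

/-- If the almost centraliser of `𝔤` in `A` is trivial, then elements `h` for which `h · A` and
`[h, 𝔤]` are finite act trivially on `A`. -/
theorem lie_eq_zero_of_almost_central
    (hA : almostCentralizerModule (⊤ : AddSubgroup 𝔤) (⊥ : AddSubgroup A) = {0}) {h : 𝔤}
    (h₁ : (Set.range fun a : A => ⁅h, a⁆).Finite) (h₂ : (Set.range fun g : 𝔤 => ⁅h, g⁆).Finite)
    (a : A) : ⁅h, a⁆ = 0 := by
  have hmem : ⁅h, a⁆ ∈ almostCentralizerModule (⊤ : AddSubgroup 𝔤) (⊥ : AddSubgroup A) := by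
    -- The set `𝔤 · (h · a)` lies in the difference set of the finite sets `h · A` and `[h, 𝔤] · a`.
    refine almostLE_bot_iff.2 ((h₁.sub (h₂.image fun x => ⁅x, a⁆)).subset ?_)
    rintro _ ⟨g, -, rfl⟩
    refine Set.mem_sub.2 ⟨_, ⟨⁅g, a⁆, rfl⟩, _, ⟨_, ⟨g, rfl⟩, rfl⟩, ?_⟩
    change ⁅h, ⁅g, a⁆⁆ - ⁅⁅h, g⁆, a⁆ = ⁅g, ⁅h, a⁆⁆
    rw [lie_lie, sub_sub_cancel]
  rwa [hA] at hmem

/-- An almost derivation vanishes at the elements of its derivation domain which act trivially on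
the module and have finite adjoint image. -/
theorem toHom_eq_zero_of_mem_derivationDomain
    (hA : almostCentralizerModule (⊤ : AddSubgroup 𝔤) (⊥ : AddSubgroup A) = {0})
    {f : PartialHom 𝔤 A} {h : 𝔤} (hh : h ∈ f.dom) (hD : h ∈ derivationDomain f)
    (h₁ : ∀ a : A, ⁅h, a⁆ = 0) (h₂ : (Set.range fun g : 𝔤 => ⁅h, g⁆).Finite) :
    f.toHom ⟨h, hh⟩ = 0 := by
  obtain ⟨_, hfin⟩ := mem_derivationDomain.1 hD
  have hmem : f.toHom ⟨h, hh⟩ ∈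
      almostCentralizerModule (⊤ : AddSubgroup 𝔤) (⊥ : AddSubgroup A) := by
    refine almostLE_bot_iff.2 ?_
    -- This finite set of values `-f x`, with `x` in `Dom f ∩ [h, 𝔤]`, contains `g · f h` for every
    -- `g ∈ D^f_h`.
    have h3 : ((fun x : f.dom => -f.toHom x) '' (Subtype.val ⁻¹' Set.range fun g => ⁅h, g⁆)).Finite :=
      (h₂.preimage Subtype.val_injective.injOn).image _
    refine (finite_range_of_finite_image (actRight (f.toHom ⟨h, hh⟩)) hfin (h3.subset ?_)).subset ?_
    · rintro _ ⟨g, ⟨hg, hg', e⟩, rfl⟩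
      refine ⟨⟨_, hg'⟩, ⟨g, rfl⟩, ?_⟩
      change -f.toHom ⟨_, hg'⟩ = ⁅g, f.toHom ⟨h, hh⟩⁆
      rw [e, h₁, zero_sub, neg_neg]
    · rintro _ ⟨g, -, rfl⟩
      exact ⟨g, rfl⟩
  rwa [hA] at hmem

/-! ### Inflation and descent of almost derivations -/

variable {𝔮 : Type*} [LieRing 𝔮] [LieRingModule 𝔮 A] {φ : 𝔤 →+ 𝔮}

theorem comap_differential (hact : ∀ (x : 𝔤) (a : A), ⁅φ x, a⁆ = ⁅x, a⁆) (a : A) :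
    PartialHomClass.comap φ (differential 𝔮 A a) = differential 𝔤 A a :=
  PartialHomClass.mk_eq_mk.2 ⟨⊤, inferInstance, fun _ _ => trivial, le_rfl, fun x _ => hact x a⟩

/-- The derivation rule for `f` at `φ g, φ x` is the rule for the pullback at `g, x`, so both
derivation domains upstairs contain the preimages of those downstairs. -/
theorem IsAlmostDerivation.comap (hlie : ∀ x y, φ ⁅x, y⁆ = ⁅φ x, φ y⁆)
    (hact : ∀ (x : 𝔤) (a : A), ⁅φ x, a⁆ = ⁅x, a⁆) {f : PartialHom 𝔮 A}
    (hf : IsAlmostDerivation f) : IsAlmostDerivation (f.comap φ) := by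
  have := finiteIndex_comap hf φ
  refine AddSubgroup.finiteIndex_of_le (H := (derivationDomain f).comap φ) fun g hg => ?_
  obtain ⟨h, hfin⟩ := mem_derivationDomain.1 hg
  refine mem_derivationDomain.2 ⟨h, ?_⟩
  have := finiteIndex_comap hfin φ
  refine AddSubgroup.finiteIndex_of_le (H := (derivationDomainAt f ⟨φ g, h⟩).comap φ) ?_
  rintro x ⟨hx, hx', e⟩
  have hx'' : φ ⁅g, x⁆ ∈ f.dom := by rwa [hlie]
  refine ⟨hx, hx'', ?_⟩
  change f.toHom ⟨φ ⁅g, x⁆, hx''⟩ = ⁅g, f.toHom ⟨φ x, hx⟩⁆ - ⁅x, f.toHom ⟨φ g, h⟩⁆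
  simp only [hlie, ← hact]
  exact e

/-- A partial homomorphism that vanishes on the kernel of `φ` within a subgroup `K` of finite index
descends along the surjection `φ`. -/
theorem exists_partialHom_descent {G G' H : Type*} [AddCommGroup G] [AddCommGroup G']
    [AddCommGroup H] {φ : G →+ G'} (hφ : Function.Surjective φ) (f : PartialHom G H)
    {K : AddSubgroup G} (hK : K.FiniteIndex) (hKf : K ≤ f.dom)
    (hker : ∀ x (hx : x ∈ K), φ x = 0 → f.toHom ⟨x, hKf hx⟩ = 0) :
    ∃ f' : PartialHom G' H, f'.dom = K.map φ ∧
      ∀ x (hx : x ∈ K) (hx' : φ x ∈ f'.dom), f'.toHom ⟨φ x, hx'⟩ = f.toHom ⟨x, hKf hx⟩ := by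
  have hle : (φ.addSubgroupMap K).ker ≤ (f.toHom.comp (AddSubgroup.inclusion hKf)).ker :=
    fun x hx => hker x x.2 (congrArg Subtype.val hx)
  have hsurj := φ.addSubgroupMap_surjective K
  -- The chosen right inverse of `K → φ(K)` is only a set-theoretic section; the lift is additive
  -- because `f` kills the kernel.
  refine ⟨⟨K.map φ, finiteIndex_map hK hφ, (φ.addSubgroupMap K).liftOfRightInverse
    (Function.surjInv hsurj) (Function.rightInverse_surjInv hsurj) ⟨_, hle⟩⟩, rfl, ?_⟩
  intro x hx hx'
  exact AddMonoidHom.liftOfRightInverse_comp_apply (φ.addSubgroupMap K) _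
    (Function.rightInverse_surjInv hsurj) ⟨_, hle⟩ ⟨x, hx⟩

/-- The substance is surjectivity: `f` vanishes on `D^f ∩ ker φ`, so its restriction to `D^f`
descends to some `f'` on `φ(D^f)`, and the pullback of `f'` agrees with `f` on `D^f`. It remains to
see that `f'` is an almost derivation. -/
theorem map_comap_almostDer (hφ : Function.Surjective φ)
    (hlie : ∀ x y, φ ⁅x, y⁆ = ⁅φ x, φ y⁆) (hact : ∀ (x : 𝔤) (a : A), ⁅φ x, a⁆ = ⁅x, a⁆)
    (hA : almostCentralizerModule (⊤ : AddSubgroup 𝔤) (⊥ : AddSubgroup A) = {0})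
    (hker : ∀ x, φ x = 0 → (Set.range fun g : 𝔤 => ⁅x, g⁆).Finite) :
    (almostDer 𝔮 A).map (PartialHomClass.comap φ) = almostDer 𝔤 A := by
  apply le_antisymm
  · rintro _ ⟨_, ⟨f, hf, rfl⟩, rfl⟩
    exact ⟨f.comap φ, hf.comap hlie hact, rfl⟩
  rintro _ ⟨f, hf, rfl⟩
  have hfin : (derivationDomain f).FiniteIndex := hf
  have hle : derivationDomain f ≤ f.dom := fun x hx => (mem_derivationDomain.1 hx).1
  obtain ⟨f', hdom, hf'⟩ := exists_partialHom_descent hφ f hf hle fun x hx hx0 =>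
    toHom_eq_zero_of_mem_derivationDomain hA (hle hx) hx
      (fun a => by rw [← hact, hx0, zero_lie]) (hker x hx0)
  have hmem : ∀ x ∈ derivationDomain f, φ x ∈ f'.dom := fun x hx => by
    rw [hdom]
    exact ⟨x, hx, rfl⟩
  refine ⟨PartialHomClass.mk f', ⟨f', ?_, rfl⟩, PartialHomClass.mk_eq_mk.2
    ⟨derivationDomain f, hfin, hmem, hle, fun x hx => hf' x hx _⟩⟩
  have := finiteIndex_map hf hφ
  refine AddSubgroup.finiteIndex_of_le (H := (derivationDomain f).map φ) ?_
  rintro _ ⟨g, hg, rfl⟩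
  obtain ⟨hgf, hgfin⟩ := mem_derivationDomain.1 hg
  refine mem_derivationDomain.2 ⟨hmem g hg, ?_⟩
  -- Membership of `x` in `D^f_g` only puts `[g, x]` in `Dom f`, while `f'` is compared with `f` on
  -- `D^f`. The extra condition `[g, x] ∈ D^f` still defines a subgroup of finite index, as the
  -- preimage of `D^f` under `ad g`.
  have h1 : ((derivationDomain f).comap (actLeft g)).FiniteIndex := finiteIndex_comap hf _
  have h2 : (derivationDomain f ⊓ derivationDomainAt f ⟨g, hgf⟩ ⊓
    (derivationDomain f).comap (actLeft g)).FiniteIndex := inferInstance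
  have h3 := finiteIndex_map h2 hφ
  refine AddSubgroup.finiteIndex_of_le (H := (derivationDomain f ⊓
    derivationDomainAt f ⟨g, hgf⟩ ⊓ (derivationDomain f).comap (actLeft g)).map φ) ?_
  rintro _ ⟨x, ⟨⟨hx, hxf, hgx, e⟩, hgx'⟩, rfl⟩
  have hmem' : ⁅φ g, φ x⁆ ∈ f'.dom := by
    rw [← hlie]
    exact hmem _ hgx'
  refine ⟨hmem x hx, hmem', ?_⟩
  change f'.toHom ⟨⁅φ g, φ x⁆, hmem'⟩ = ⁅φ g, f'.toHom ⟨φ x, hmem x hx⟩⁆ -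
    ⁅φ x, f'.toHom ⟨φ g, hmem g hg⟩⁆
  simp only [← hlie]
  rw [hf' ⁅g, x⁆ hgx', hf' _ hx, hf' _ hg, hact, hact]
  exact e

/-- Inflation along a surjection whose kernel almost centralises `𝔤` is an isomorphism of first
almost cohomology groups, if the almost centraliser of `𝔤` in `A` is trivial. -/
theorem nonempty_almostH1_addEquiv (hφ : Function.Surjective φ)
    (hlie : ∀ x y, φ ⁅x, y⁆ = ⁅φ x, φ y⁆) (hact : ∀ (x : 𝔤) (a : A), ⁅φ x, a⁆ = ⁅x, a⁆)
    (hA : almostCentralizerModule (⊤ : AddSubgroup 𝔤) (⊥ : AddSubgroup A) = {0})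
    (hker : ∀ x, φ x = 0 → (Set.range fun g : 𝔤 => ⁅x, g⁆).Finite) :
    Nonempty (AlmostH1 𝔮 A ≃+ AlmostH1 𝔤 A) := by
  have hinj := PartialHomClass.comap_injective (H := A) hφ
  let e : almostDer 𝔮 A ≃+ almostDer 𝔤 A :=
    ((almostDer 𝔮 A).equivMapOfInjective _ hinj).trans
      (AddEquiv.addSubgroupCongr (map_comap_almostDer hφ hlie hact hA hker))
  refine ⟨QuotientAddGroup.congr _ _ e ?_⟩
  -- Inflation sends the inner class of `a` over `𝔮` to the inner class of `a` over `𝔤`, so `e`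
  -- carries one subgroup of inner classes onto the other.
  ext c
  constructor
  · rintro ⟨x, ⟨a, ha⟩, rfl⟩
    refine ⟨a, ?_⟩
    rw [← comap_differential hact, ha]
    rfl
  · rintro ⟨a, ha⟩
    refine ⟨⟨differential 𝔮 A a, range_differential_le 𝔮 A ⟨a, rfl⟩⟩, ⟨a, rfl⟩, Subtype.ext ?_⟩
    exact (comap_differential hact a).trans ha

end Inflation

end AlmostCohomology

theorem corollary5p6 {L : FirstOrder.Language.{u, v}} (T : L.Theory)
    (hT : AlmostCohomology.IsFiniteDimensional.{u, v, w} T)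
    (M : FirstOrder.Language.Theory.ModelType.{u, v, w} T)
    {𝔤 A : Type*} [LieRing 𝔤] [AddCommGroup A] [LieRingModule 𝔤 A]
    (D : AlmostCohomology.DefinableModule L M 𝔤 A)
    (hA : AlmostCohomology.almostCentralizerModule (⊤ : AddSubgroup 𝔤) (⊥ : AddSubgroup A) = {0})
    (𝔥 : LieIdeal ℤ 𝔤) (h𝔥 : D.coordLie.IsDefinable (𝔥 : Set 𝔤))
    (hle : (𝔥 : Set 𝔤) ⊆
      AlmostCohomology.almostCentralizerLie 𝔤 (⊤ : AddSubgroup A) ⊥ ∩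
        AlmostCohomology.almostCenter 𝔤) :
    ∃ htriv : ∀ x ∈ 𝔥, ∀ a : A, ⁅x, a⁆ = 0,
      letI : LieRingModule (𝔤 ⧸ 𝔥) A := AlmostCohomology.quotientModule 𝔥 htriv
      AlmostCohomology.Isogenous (AlmostCohomology.AlmostH1 (𝔤 ⧸ 𝔥) A)
        (AlmostCohomology.AlmostH1 𝔤 A) := by
  have h₁ : ∀ x ∈ 𝔥, (Set.range fun a : A => ⁅x, a⁆).Finite := fun x hx => by
    refine (AlmostCohomology.almostLE_bot_iff.1 (hle hx).1).subset ?_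
    rintro _ ⟨a, rfl⟩
    exact ⟨a, trivial, rfl⟩
  have h₂ : ∀ x ∈ 𝔥, (Set.range fun g : 𝔤 => ⁅x, g⁆).Finite := fun x hx => by
    refine (AlmostCohomology.almostLE_bot_iff.1 (hle hx).2).subset ?_
    rintro _ ⟨g, rfl⟩
    exact ⟨g, trivial, rfl⟩
  have htriv : ∀ x ∈ 𝔥, ∀ a : A, ⁅x, a⁆ = 0 := fun x hx a =>
    AlmostCohomology.lie_eq_zero_of_almost_central hA (h₁ x hx) (h₂ x hx) a
  refine ⟨htriv, ?_⟩
  let : LieRingModule (𝔤 ⧸ 𝔥) A := AlmostCohomology.quotientModule 𝔥 htriv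
  -- Compatibility with bracket and action holds by `rfl`, as both are defined on representatives in
  -- `𝔤 ⧸ 𝔥`.
  obtain ⟨e⟩ := AlmostCohomology.nonempty_almostH1_addEquiv (𝔤 := 𝔤) (A := A) (𝔮 := 𝔤 ⧸ 𝔥)
    (φ := (LieSubmodule.Quotient.mk' 𝔥 : 𝔤 →ₗ[ℤ] 𝔤 ⧸ 𝔥).toAddMonoidHom)
    (LieSubmodule.Quotient.surjective_mk' 𝔥) (fun _ _ => rfl) (fun _ _ => rfl) hA
    (fun x hx => h₂ x ((LieSubmodule.Quotient.mk_eq_zero 𝔥).1 hx))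
  exact AlmostCohomology.Isogenous.of_addEquiv e
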